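/- Let $\mathbb{N}=\{0,1,2,\dots\}$ and $\mathbb{R}_+=(0,\infty)$. For an $m\times m$ Hermitian matrix $A$ ($m\ge 1$) let $\Omega(A)=\{[z]\in\mathbb{CP}^{m-1}:\langle Az,z\rangle>0\}$, where $\langle z,w\rangle=\sum_j z_j\overline{w_j}$, and let $\mathrm{vol}_{FS}$ be the Riemannian volume of the Fubini–Study metric on $\mathbb{CP}^{m-1}$, normalized to have holomorphic sectional curvature $4$ (so that $\mathrm{dist}([z],[w])=\arccos\frac{|\langle z,w\rangle|}{\|z\|\,\|w\|}$), with $\mathrm{vol}_{FS}(\mathbb{CP}^0)=1$. For $p,q\in\mathbb{N}$, $x\in\mathbb{R}_+^p$ and $y\in\mathbb{R}_+^q$ put $D_{(p,q)}(x,y)=\prod_{k=1}^q\prod_{j=1}^p(x_j+y_k)$ (empty products are $1$), and for $(p,q)\ne(0,0)$ put $$N_{(p,q)}(x,y)=\frac{(p+q-1)!}{\pi^{p+q-1}}\, D_{(p,q)}(x,y)\,\mathrm{vol}_{FS}\bigl(\Omega(\mathrm{diag}(x_1,\dots,x_p,-y_1,\dots,-y_q))\bigr);$$ put $N_{(0,0)}=0$.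 Then: (1) For all $p,q\in\mathbb{N}$, $N_{(p,q)}$ is a continuous function $\mathbb{R}_+^p\times\mathbb{R}_+^q\to[0,\infty)$, strictly positive if $p\ge1$, symmetric in $x_1,\dots,x_p$ and symmetric in $y_1,\dots,y_q$. (2) (Base condition) $N_{(0,0)}=0$, and $N_{(1,0)}(x,\cdot)=1$ for all $x\in\mathbb{R}_+$. (3) (Duality) For all $(p,q)\ne(0,0)$, $x\in\mathbb{R}_+^p$, $y\in\mathbb{R}_+^q$: $N_{(p,q)}(x,y)=D_{(p,q)}(x,y)-N_{(q,p)}(y,x)$. (4) (Recursion) For all $p\ge 0$, $q\ge1$, $x\in\mathbb{R}_+^p$ and $y\in\mathbb{R}_+^q$ with $y_1<y_2<\dots<y_q$, $$N_{(p,q)}(x,y)=\Bigl(\prod_{j=1}^p(x_j+y_q)\Bigr)N_{(p,q-1)}\bigl(x,(y_1,\dots,y_{q-1})\bigr)-T_{(p,q)}(x,y)\,N_{(p,q-1)}(\alpha,\beta),$$ where $$T_{(p,q)}(x,y)=\frac{1}{y_q^{\,pq-2p-q+1}}\prod_{j=1}^p(y_q+x_j)^{q-1}\prod_{k=1}^{q-1}(y_q-y_k)^{p-1},$$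 $\alpha=\bigl(\tfrac{x_j}{y_q+x_j}\bigr)_{1\le j\le p}$ and $\beta=\bigl(\tfrac{y_k}{y_q-y_k}\bigr)_{1\le k\le q-1}$. -/

import Mathlib

open scoped BigOperators LinearAlgebra.Projectivization ENNReal Nat

noncomputable section

namespace QuadricVolume

/-- The quadric domain of a matrix `A`: the set of points `[z]` of complex projective space
with `⟨A z, z⟩ > 0`, where `⟨z, w⟩ = ∑ j, z j * conj (w j)`. (For Hermitian `A` the number
`⟨A z, z⟩` is real.) The matrix has size `m`, so the projective space is `ℂℙ^(m-1)`. -/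
def quadricDomain {m : ℕ} (A : Matrix (Fin m) (Fin m) ℂ) : Set (ℙ ℂ (Fin m → ℂ)) :=
  {P | ∃ (z : Fin m → ℂ) (hz : z ≠ 0), P = Projectivization.mk ℂ z hz ∧
    0 < (∑ j, (A.mulVec z) j * (starRingEnd ℂ) (z j)).re}

theorem snoc_one_ne_zero {n : ℕ} (ζ : Fin n → ℂ) :
    (Fin.snoc (α := fun _ => ℂ) ζ 1 : Fin (n + 1) → ℂ) ≠ 0 := by
  intro h
  have h1 := congrFun h (Fin.last n)
  simp at h1

/-- The parametrization `ζ ↦ [(ζ₁, …, ζₙ, 1)]` of the affine piece `z_{n+1} ≠ 0` of `ℂℙⁿ`. -/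
def affineChart {n : ℕ} (ζ : Fin n → ℂ) : ℙ ℂ (Fin (n + 1) → ℂ) :=
  Projectivization.mk ℂ (Fin.snoc (α := fun _ => ℂ) ζ 1) (snoc_one_ne_zero ζ)

/-- The Fubini-Study Riemannian metric in affine coordinates, at the point `ζ`, on tangent
vectors `v`, `w`: the real part of `∑ j k, (∂²φ / ∂ζ_j ∂ζ̄_k) v_j w̄_k` for the potential
`φ = log (1 + |ζ|²)`. In this normalization the holomorphic sectional curvature is `4` and
the distance of `[z]` and `[w]` is `arccos (|⟨z, w⟩| / (‖z‖ ‖w‖))`. -/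
def fsMetric {n : ℕ} (ζ v w : Fin n → ℂ) : ℝ :=
  ((1 + ∑ j, Complex.normSq (ζ j)) * (∑ j, v j * (starRingEnd ℂ) (w j)).re
      - ((∑ j, v j * (starRingEnd ℂ) (ζ j)) * (∑ k, ζ k * (starRingEnd ℂ) (w k))).re)
    / (1 + ∑ j, Complex.normSq (ζ j)) ^ 2

/-- The standard real basis of `ℂⁿ = ℝ²ⁿ`: `(j, 0) ↦ e_j` and `(j, 1) ↦ i e_j`. -/
def realBasisVec {n : ℕ} (a : Fin n × Fin 2) : Fin n → ℂ :=
  Pi.single a.1 (if a.2 = 0 then 1 else Complex.I)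

/-- The Riemannian volume density `√(det g)` of the Fubini-Study metric, relative to Lebesgue
measure on `ℂⁿ = ℝ²ⁿ`. -/
def fsDensity {n : ℕ} (ζ : Fin n → ℂ) : ℝ :=
  Real.sqrt (Matrix.det (Matrix.of fun a b : Fin n × Fin 2 =>
    fsMetric ζ (realBasisVec a) (realBasisVec b)))

/-- The Riemannian volume of a subset of `ℂℙ^(m-1)` for the Fubini-Study metric, computed in the
affine piece `z_m ≠ 0`, whose complement is a hyperplane and hence a null set.
`ℂℙ⁰` is a point, of volume `1`; for `m = 0` the projective space is empty. -/
def fsVolume : {m : ℕ} → Set (ℙ ℂ (Fin m → ℂ)) → ℝ≥0∞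
  | 0, _ => 0
  | _ + 1, U => ∫⁻ ζ in affineChart ⁻¹' U, ENNReal.ofReal (fsDensity ζ)

/-- The diagonal matrix `diag(x₁, …, x_p, -y₁, …, -y_q)`. -/
def diagMatrix {p q : ℕ} (x : Fin p → ℝ) (y : Fin q → ℝ) :
    Matrix (Fin (p + q)) (Fin (p + q)) ℂ :=
  Matrix.diagonal fun i => ((Fin.append x (fun k => -y k) i : ℝ) : ℂ)

/-- `D_{(p,q)}(x, y) = ∏ k, ∏ j, (x_j + y_k)`. -/
def D {p q : ℕ} (x : Fin p → ℝ) (y : Fin q → ℝ) : ℝ :=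
  ∏ k, ∏ j, (x j + y k)

/-- The factor `T_{(p,q+1)}(x, y)`, for a `(q+1)`-tuple `y`. -/
def T {p q : ℕ} (x : Fin p → ℝ) (y : Fin (q + 1) → ℝ) : ℝ :=
  1 / y (Fin.last q) ^ ((p : ℤ) * (q + 1 : ℕ) - 2 * p - (q + 1 : ℕ) + 1)
    * (∏ j, (y (Fin.last q) + x j) ^ q)
    * ∏ k : Fin q, (y (Fin.last q) - y k.castSucc) ^ ((p : ℤ) - 1)

/-- The tuple `α_j = x_j / (y_last + x_j)`. -/
def alpha {p q : ℕ} (x : Fin p → ℝ) (y : Fin (q + 1) → ℝ) : Fin p → ℝ :=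
  fun j => x j / (y (Fin.last q) + x j)

/-- The tuple `β_k = y_k / (y_last - y_k)`, over all indices `k` but the last. -/
def beta {q : ℕ} (y : Fin (q + 1) → ℝ) : Fin q → ℝ :=
  fun k => y k.castSucc / (y (Fin.last q) - y k.castSucc)

/-- The open orthant `ℝ₊ⁿ`. -/
def orthant (n : ℕ) : Set (Fin n → ℝ) := {x | ∀ i, 0 < x i}

/-- The class `𝒩` of double sequences of functions `N_{(p,q)}` on `ℝ₊^p × ℝ₊^q`. Functions are
written as total functions, of which only the values on the orthants are constrained. -/
structure ClassN (N : (p q : ℕ) → (Fin p → ℝ) → (Fin q → ℝ) → ℝ) : Prop where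
  continuousOn : ∀ p q : ℕ,
    ContinuousOn (fun z : (Fin p → ℝ) × (Fin q → ℝ) => N p q z.1 z.2)
      (orthant p ×ˢ orthant q)
  nonneg : ∀ p q : ℕ, ∀ x ∈ orthant p, ∀ y ∈ orthant q, 0 ≤ N p q x y
  pos : ∀ p q : ℕ, 1 ≤ p → ∀ x ∈ orthant p, ∀ y ∈ orthant q, 0 < N p q x y
  symm : ∀ p q : ℕ, ∀ x ∈ orthant p, ∀ y ∈ orthant q,
    ∀ (s : Equiv.Perm (Fin p)) (t : Equiv.Perm (Fin q)),
      N p q (fun j => x (s j)) (fun k => y (t k)) = N p q x y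
  base_zero : ∀ x ∈ orthant 0, ∀ y ∈ orthant 0, N 0 0 x y = 0
  base_one : ∀ x ∈ orthant 1, ∀ y ∈ orthant 0, N 1 0 x y = 1
  duality : ∀ p q : ℕ, (p, q) ≠ (0, 0) → ∀ x ∈ orthant p, ∀ y ∈ orthant q,
    N p q x y = D x y - N q p y x
  recursion : ∀ p q : ℕ, ∀ x ∈ orthant p, ∀ y ∈ orthant (q + 1), StrictMono y →
    N p (q + 1) x y =
      (∏ j, (x j + y (Fin.last q))) * N p q x (fun k => y k.castSucc)
        - T x y * N p q (alpha x y) (beta y)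

/-- The normalized volumes
`N_{(p,q)}(x, y) = (p+q-1)! / π^(p+q-1) * D_{(p,q)}(x, y) * vol_FS (Ω (diag(x, -y)))`
for `(p, q) ≠ (0, 0)`, and `N_{(0,0)} = 0`. -/
def normalizedVolume (p q : ℕ) (x : Fin p → ℝ) (y : Fin q → ℝ) : ℝ :=
  if (p, q) = (0, 0) then 0
  else ((p + q - 1)! : ℝ) / Real.pi ^ (p + q - 1) * D x y
    * (fsVolume (quadricDomain (diagMatrix x y))).toReal

end QuadricVolume

end

/-! The normalized volume is a probability: for a real vector `a` of length `n + 1`, `n! / π ^ n`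
times the volume of `Ω(diag a)` is the probability that `∑ a i * E i > 0` for independent standard
exponential `E i` (`factorial_mul_fsVolume`). Hence `N_{(p,q)} = D * expProb (x, -y)`
(`normalizedVolume_eq`).

Symmetry then holds because the `E i` are i.i.d. Duality is passage to the complement, the event `∑
a i * E i = 0` being null for `a ≠ 0`; the same null event gives continuity. A positive coefficient
makes the probability positive.

The recursion (`expProb_eq_snoc_add`) comes from integrating out the variable with coefficient `-s`,
where `s = y_q`. Given the others, with sum `S > 0`, the probability that `S - s * E ≤ 0` is `exp
(-S / s)`. This weight is a product over the coordinates; it only changes the rates of the remaining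
exponentials, and rescaling them yields the coefficients `a i / (s + a i)`, that is, `α` and `-β`.
The factor `T` is what remains after the factors `D` are inserted (`T_mul_D`). -/

namespace QuadricVolume

open MeasureTheory Set

/-! ### The exponential distribution -/

/-- The standard exponential distribution on `ℝ`. -/
noncomputable def stdExp : Measure ℝ :=
  (volume.restrict (Ioi 0)).withDensity fun t => ENNReal.ofReal (Real.exp (-t))

theorem lintegral_stdExp {f : ℝ → ℝ≥0∞} (hf : Measurable f) :
    ∫⁻ t, f t ∂stdExp = ∫⁻ t in Ioi (0 : ℝ), ENNReal.ofReal (Real.exp (-t)) * f t := by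
  rw [stdExp, lintegral_withDensity_eq_lintegral_mul _ (by fun_prop) hf]
  rfl

theorem lintegral_exp_neg_Ioi (c : ℝ) :
    ∫⁻ t in Ioi c, ENNReal.ofReal (Real.exp (-t)) = ENNReal.ofReal (Real.exp (-c)) := by
  rw [← ofReal_integral_eq_lintegral_ofReal, integral_exp_neg_Ioi]
  · exact integrableOn_exp_neg_Ioi c
  · exact ae_of_all _ fun t => (Real.exp_pos _).le

theorem stdExp_Ioi {c : ℝ} (hc : 0 ≤ c) : stdExp (Ioi c) = ENNReal.ofReal (Real.exp (-c)) := by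
  rw [stdExp, withDensity_apply _ measurableSet_Ioi, Measure.restrict_restrict measurableSet_Ioi,
    Ioi_inter_Ioi, max_eq_left hc, lintegral_exp_neg_Ioi]

instance : IsProbabilityMeasure stdExp := by
  constructor
  rw [stdExp, withDensity_apply _ MeasurableSet.univ, Measure.restrict_univ, lintegral_exp_neg_Ioi]
  simp

theorem stdExp_absolutelyContinuous : stdExp ≪ volume :=
  (withDensity_absolutelyContinuous _ _).trans Measure.restrict_le_self.absolutelyContinuous

theorem stdExp_Ici {c : ℝ} (hc : 0 ≤ c) : stdExp (Ici c) = ENNReal.ofReal (Real.exp (-c)) := by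
  rw [← stdExp_Ioi hc]
  exact measure_congr (stdExp_absolutelyContinuous.ae_eq Ioi_ae_eq_Ici.symm)

theorem stdExp_Iio_add {c : ℝ} (hc : 0 ≤ c) :
    stdExp (Iio c) + ENNReal.ofReal (Real.exp (-c)) = 1 := by
  rw [← stdExp_Ici hc, ← compl_Iio]
  exact prob_add_prob_compl measurableSet_Iio

theorem stdExp_Iio_of_nonpos {c : ℝ} (hc : c ≤ 0) : stdExp (Iio c) = 0 := by
  have h := stdExp_Iio_add le_rfl
  have h0 : stdExp (Iio (0 : ℝ)) = 0 := by
    simpa using h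
  exact measure_mono_null (Iio_subset_Iio hc) h0

theorem stdExp_Ioo_pos {b : ℝ} (hb : 0 < b) : 0 < stdExp (Ioo 0 b) := by
  have h : stdExp (Ioi 0) ≤ stdExp (Ioo 0 b) + stdExp (Ici b) :=
    (measure_mono fun t ht => (lt_or_ge t b).imp (fun h => ⟨ht, h⟩) id).trans (measure_union_le _ _)
  by_contra h0
  rw [nonpos_iff_eq_zero.1 (not_lt.1 h0), zero_add, stdExp_Ioi le_rfl, stdExp_Ici hb.le,
    ENNReal.ofReal_le_ofReal_iff (Real.exp_pos _).le, Real.exp_le_exp] at h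
  linarith

/-! ### Product measures and coordinatewise change of variables -/

theorem lintegral_pi_snoc {n : ℕ} {α : Type*} [MeasurableSpace α] (μ : Measure α) [SigmaFinite μ]
    {f : (Fin (n + 1) → α) → ℝ≥0∞} (hf : Measurable f) :
    ∫⁻ t, f t ∂Measure.pi (fun _ => μ) =
      ∫⁻ t, ∫⁻ u, f (Fin.snoc (α := fun _ => α) t u) ∂μ ∂Measure.pi (fun _ : Fin n => μ) := by
  have h := (measurePreserving_piFinSuccAbove (fun _ : Fin (n + 1) => μ) (Fin.last n)).symm
  have h1 : ∀ z : α × (Fin n → α),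
      (MeasurableEquiv.piFinSuccAbove (fun _ => α) (Fin.last n)).symm z =
        Fin.snoc (α := fun _ => α) z.2 z.1 := fun z => Fin.insertNth_last' z.1 z.2
  rw [← h.lintegral_comp hf]
  refine (lintegral_prod_symm' _ (hf.comp h.measurable)).trans ?_
  exact lintegral_congr fun t => lintegral_congr fun u => congrArg f (h1 (u, t))

theorem lintegral_fin_prod_eq_prod {n : ℕ} {α : Type*} [MeasurableSpace α]
    (μ : Measure α) [SigmaFinite μ] {g : Fin n → α → ℝ≥0∞} (hg : ∀ i, Measurable (g i)) :
    ∫⁻ t, ∏ i, g i (t i) ∂Measure.pi (fun _ => μ) = ∏ i, ∫⁻ s, g i s ∂μ := by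
  induction n with
  | zero => simp
  | succ n ih =>
    rw [lintegral_pi_snoc μ (by fun_prop)]
    simp only [Fin.prod_univ_castSucc, Fin.snoc_castSucc, Fin.snoc_last]
    simp_rw [lintegral_const_mul _ (hg _)]
    rw [lintegral_mul_const _ (by fun_prop), ih fun i => hg i.castSucc]

/-- Coordinatewise change of variables for a product measure with a product density. -/
theorem pi_withDensity_map {n : ℕ} {α β : Type*} [MeasurableSpace α]
    [MeasurableSpace β] (μ : Measure α) [SigmaFinite μ]
    (ν : Fin n → Measure β) [∀ i, SigmaFinite (ν i)] {g : Fin n → α → ℝ≥0∞}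
    (hg : ∀ i, Measurable (g i)) {θ : Fin n → α → β} (hθ : ∀ i, Measurable (θ i))
    (h : ∀ i, (μ.withDensity (g i)).map (θ i) = ν i) :
    ((Measure.pi fun _ => μ).withDensity fun t => ∏ i, g i (t i)).map (fun t i => θ i (t i)) =
      Measure.pi ν := by
  symm
  apply Measure.pi_eq
  intro s hs
  have hpre : (fun (t : Fin n → α) i => θ i (t i)) ⁻¹' univ.pi s =
      univ.pi fun i => θ i ⁻¹' s i := by
    ext; simp
  have hms : ∀ i, MeasurableSet (θ i ⁻¹' s i) := fun i => hθ i (hs i)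
  rw [Measure.map_apply (by fun_prop) (.univ_pi hs), hpre, withDensity_apply _ (.univ_pi hms),
    ← lintegral_indicator (.univ_pi hms)]
  have hind : ∀ t : Fin n → α, (univ.pi fun i => θ i ⁻¹' s i).indicator
      (fun t => ∏ i, g i (t i)) t = ∏ i, (θ i ⁻¹' s i).indicator (g i) (t i) := by
    intro t
    by_cases ht : t ∈ univ.pi fun i => θ i ⁻¹' s i
    · rw [indicator_of_mem ht]
      exact Finset.prod_congr rfl fun i _ => (indicator_of_mem (ht i (mem_univ i)) _).symm
    · rw [indicator_of_notMem ht]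
      simp only [mem_pi, mem_univ, forall_const, not_forall] at ht
      obtain ⟨i, hi⟩ := ht
      exact (Finset.prod_eq_zero (Finset.mem_univ i) (indicator_of_notMem hi _)).symm
  rw [lintegral_congr hind, lintegral_fin_prod_eq_prod _ fun i => (hg i).indicator (hms i)]
  refine Finset.prod_congr rfl fun i _ => ?_
  rw [← h i, Measure.map_apply (hθ i) (hs i), withDensity_apply _ (hms i),
    lintegral_indicator (hms i)]

theorem pi_const_smul {n : ℕ} {β : Type*} [MeasurableSpace β]
    (ν : Measure β) [IsFiniteMeasure ν] (c : Fin n → NNReal) :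
    Measure.pi (fun i => c i • ν) = (∏ i, c i) • Measure.pi (fun _ : Fin n => ν) := by
  apply Measure.pi_eq
  intro s hs
  rw [Measure.smul_apply, Measure.pi_pi, ENNReal.smul_def, smul_eq_mul, ENNReal.ofNNReal_finsetProd,
    ← Finset.prod_mul_distrib]
  rfl

/-- Serves two substitutions: `t = u * |z|²` from `ℂ` to the half-line (`normSq_map`), and the
change of rate of exponential variables (`stdExp_tilt`). The constants `c i` record the total masses
of the one-dimensional weighted measures. -/
theorem lintegral_pi_change {n : ℕ} {α β : Type*} [MeasurableSpace α]
    [MeasurableSpace β] (μ : Measure α) [SigmaFinite μ]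
    (ν : Measure β) [IsFiniteMeasure ν] {g : Fin n → α → ℝ≥0∞}
    (hg : ∀ i, Measurable (g i)) {θ : Fin n → α → β} (hθ : ∀ i, Measurable (θ i))
    (c : Fin n → NNReal)
    (h : ∀ i, (μ.withDensity (g i)).map (θ i) = c i • ν) {f : (Fin n → β) → ℝ≥0∞}
    (hf : Measurable f) :
    ∫⁻ t, (∏ i, g i (t i)) * f (fun i => θ i (t i)) ∂Measure.pi (fun _ => μ) =
      (∏ i, (c i : ℝ≥0∞)) * ∫⁻ t, f t ∂Measure.pi (fun _ => ν) := by
  have hm : Measurable fun (t : Fin n → α) i => θ i (t i) := by fun_prop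
  have key := pi_withDensity_map μ (fun i => c i • ν) hg hθ h
  rw [pi_const_smul] at key
  have h2 := congrArg (fun m => ∫⁻ t, f t ∂m) key
  simp only [lintegral_smul_measure] at h2
  rw [lintegral_map hf hm, lintegral_withDensity_eq_lintegral_mul _ (by fun_prop)
    (g := fun t : Fin n → α => f fun i => θ i (t i)) (hf.comp hm), ENNReal.smul_def, smul_eq_mul,
    ENNReal.ofNNReal_finsetProd] at h2
  exact h2

/-- The weight turns the density `exp (-t)` into `exp (-r * t)`, which has mass `r⁻¹` and becomes
standard again after scaling by `r`. -/
theorem stdExp_tilt {r : ℝ} (hr : 0 < r) :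
    (stdExp.withDensity fun t => ENNReal.ofReal (Real.exp ((1 - r) * t))).map (fun t => r * t) =
      r⁻¹.toNNReal • stdExp := by
  refine Measure.ext_of_lintegral _ fun f hf => ?_
  rw [lintegral_map hf (by fun_prop), lintegral_withDensity_eq_lintegral_mul _ (by fun_prop)
    (g := fun t => f (r * t)) (hf.comp (by fun_prop)), lintegral_smul_measure, lintegral_stdExp hf,
    lintegral_stdExp (by fun_prop)]
  have him : (fun t => r * t) '' Ioi (0 : ℝ) = Ioi 0 := by
    simpa using image_mul_left_Ioi hr 0
  have := lintegral_image_eq_lintegral_abs_deriv_mul (measurableSet_Ioi (a := (0 : ℝ)))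
    (f := fun t => r * t) (f' := fun _ => r)
    (fun x _ => by simpa using ((hasDerivAt_id x).const_mul r).hasDerivWithinAt)
    (fun x _ y _ h => mul_left_cancel₀ hr.ne' h)
    (fun t => ENNReal.ofReal (Real.exp (-t)) * f t)
  rw [him] at this
  rw [this, lintegral_const_mul _ (by fun_prop), abs_of_pos hr, ENNReal.smul_def, smul_eq_mul,
    ← mul_assoc]
  have hc : ((r⁻¹.toNNReal : NNReal) : ℝ≥0∞) * ENNReal.ofReal r = 1 := by
    rw [← ENNReal.ofReal, ← ENNReal.ofReal_mul (by positivity), inv_mul_cancel₀ hr.ne']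
    simp
  rw [hc, one_mul]
  refine lintegral_congr fun t => ?_
  simp only [Pi.mul_apply]
  rw [← mul_assoc, ← ENNReal.ofReal_mul (Real.exp_pos _).le, ← Real.exp_add]
  ring_nf

/-- In polar coordinates `dA = r dr dθ`, and `t = u * r ^ 2` gives `dt = 2 * u * r dr`; the angle
contributes `2 * π`, so the total mass is `π`. -/
theorem normSq_map {u : ℝ} (hu : 0 < u) :
    ((volume : Measure ℂ).withDensity
      fun z => ENNReal.ofReal (u * Real.exp (-(u * Complex.normSq z)))).map
        (fun z => u * Complex.normSq z) = NNReal.pi • stdExp := by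
  have hq : Measurable Complex.normSq := Complex.continuous_normSq.measurable
  have hm : Measurable fun z : ℂ => u * Complex.normSq z :=
    (Complex.continuous_normSq.const_mul u).measurable
  refine Measure.ext_of_lintegral _ fun f hf => ?_
  rw [lintegral_map hf hm, lintegral_withDensity_eq_lintegral_mul _ (by fun_prop)
    (g := fun z => f (u * Complex.normSq z)) (hf.comp hm), lintegral_smul_measure, lintegral_stdExp hf,
    ← Complex.lintegral_comp_polarCoord_symm, polarCoord_target]
  have him : (fun r => u * r ^ 2) '' Ioi (0 : ℝ) = Ioi 0 := by
    ext t
    simp only [mem_image, mem_Ioi]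
    constructor
    · rintro ⟨r, hr, rfl⟩
      positivity
    · intro ht
      refine ⟨√(t / u), by positivity, ?_⟩
      rw [Real.sq_sqrt (by positivity)]
      field_simp
  have := lintegral_image_eq_lintegral_abs_deriv_mul (measurableSet_Ioi (a := (0 : ℝ)))
    (f := fun r => u * r ^ 2) (f' := fun r => u * (2 * r))
    (fun x _ => by simpa using ((hasDerivAt_pow 2 x).const_mul u).hasDerivWithinAt)
    (fun x hx y hy h => (pow_left_inj₀ hx.le hy.le two_ne_zero).1 (mul_left_cancel₀ hu.ne' h))
    (fun t => ENNReal.ofReal (Real.exp (-t)) * f t)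
  rw [him] at this
  rw [this, Measure.volume_eq_prod, ← Measure.prod_restrict, lintegral_prod]
  · rw [ENNReal.smul_def, smul_eq_mul, ← lintegral_const_mul _ (by fun_prop)]
    refine setLIntegral_congr_fun measurableSet_Ioi fun r hr => ?_
    have hr' : (0 : ℝ) < r := hr
    have hpi : ENNReal.ofReal (Real.pi + Real.pi) = 2 * (NNReal.pi : ℝ≥0∞) := by
      rw [← two_mul, ENNReal.ofReal_mul zero_le_two, ← NNReal.coe_real_pi,
        ENNReal.ofReal_coe_nnreal, ENNReal.ofReal_ofNat]
    simp [Complex.normSq_eq_norm_sq, abs_of_pos hr', abs_of_pos hu, hpi,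
      ENNReal.ofReal_mul hu.le]
    ring
  · have hc : Continuous Complex.polarCoord.symm := by
      have : (Complex.polarCoord.symm : ℝ × ℝ → ℂ) = fun p =>
          p.1 * (Real.cos p.2 + Real.sin p.2 * Complex.I) :=
        funext Complex.polarCoord_symm_apply
      rw [this]
      fun_prop
    have := hc.measurable
    simp only [Pi.mul_apply]
    fun_prop

/-! ### The Fubini–Study density and quadric domains in the affine chart -/

theorem one_add_sum_normSq_pos {n : ℕ} (ζ : Fin n → ℂ) :
    0 < 1 + ∑ j, Complex.normSq (ζ j) :=
  add_pos_of_pos_of_nonneg one_pos (Finset.sum_nonneg fun _ _ => Complex.normSq_nonneg _)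

/-- With `s = 1 + |ζ|²` the Gram matrix is `s⁻¹ • (1 - s⁻¹ • B * Bᵀ)`, a rank-two perturbation of a
scalar matrix. The identity `det (1 - B * C) = det (1 - C * B)` reduces its determinant to a 2 × 2
one, giving `s ^ (-2n) * s ^ (-2)`. -/
theorem fsDensity_eq {n : ℕ} (ζ : Fin n → ℂ) :
    fsDensity ζ = ((1 + ∑ j, Complex.normSq (ζ j)) ^ (n + 1))⁻¹ := by
  set s := 1 + ∑ j, Complex.normSq (ζ j) with hs
  have hs0 : 0 < s := one_add_sum_normSq_pos ζ
  -- The columns of `B` are the real coordinates of `ζ` and `i ζ`; they are orthogonal of squared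
  -- length `|ζ|²`.
  set B : Matrix (Fin n × Fin 2) (Fin 2) ℝ := Matrix.of fun a c =>
    if a.2 = 0 then (if c = 0 then (ζ a.1).re else -(ζ a.1).im)
      else (if c = 0 then (ζ a.1).im else (ζ a.1).re) with hB
  have hG : (Matrix.of fun a b : Fin n × Fin 2 => fsMetric ζ (realBasisVec a) (realBasisVec b)) =
      s⁻¹ • (1 - B * (s⁻¹ • B.transpose)) := by
    ext ⟨i, c⟩ ⟨j, d⟩
    have e1 : (∑ k, realBasisVec (i, c) k * (starRingEnd ℂ) (realBasisVec (j, d) k)).re =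
        (1 : Matrix (Fin n × Fin 2) (Fin n × Fin 2) ℝ) (i, c) (j, d) := by
      simp only [realBasisVec, Pi.single_apply, ite_mul, zero_mul, Finset.sum_ite_eq',
        Finset.mem_univ, if_true, Matrix.one_apply, Prod.mk.injEq]
      by_cases hij : i = j <;> fin_cases c <;> fin_cases d <;> simp [hij]
    have e2 : ∑ k, realBasisVec (i, c) k * (starRingEnd ℂ) (ζ k) =
        ⟨B (i, c) 0, B (i, c) 1⟩ := by
      simp only [realBasisVec, Pi.single_apply, ite_mul, zero_mul, Finset.sum_ite_eq',
        Finset.mem_univ, if_true]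
      fin_cases c <;> simp [hB, Complex.ext_iff]
    have e3 : ∑ k, ζ k * (starRingEnd ℂ) (realBasisVec (j, d) k) =
        ⟨B (j, d) 0, -B (j, d) 1⟩ := by
      simp only [realBasisVec, Pi.single_apply, apply_ite (starRingEnd ℂ), map_zero, mul_ite,
        mul_zero, Finset.sum_ite_eq', Finset.mem_univ, if_true]
      fin_cases d <;> simp [hB, Complex.ext_iff]
    simp only [Matrix.of_apply, fsMetric, ← hs, e1, e2, e3, Matrix.smul_apply, Matrix.sub_apply,
      Matrix.mul_apply, Fin.sum_univ_two, Matrix.transpose_apply, smul_eq_mul, Complex.mul_re]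
    field_simp
    ring
  have hBB : s⁻¹ • B.transpose * B = (1 - s⁻¹) • (1 : Matrix (Fin 2) (Fin 2) ℝ) := by
    have hsum : ∑ j, Complex.normSq (ζ j) = s - 1 := by rw [hs]; ring
    have h1 : 1 - s⁻¹ = s⁻¹ * ∑ j, Complex.normSq (ζ j) := by rw [hsum]; field_simp
    rw [h1, Matrix.smul_mul, mul_smul]
    congr 1
    ext c d
    simp only [Matrix.mul_apply, Fintype.sum_prod_type, Fin.sum_univ_two, Matrix.transpose_apply,
      Matrix.smul_apply, smul_eq_mul, Matrix.one_apply]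
    fin_cases c <;> fin_cases d <;> simp [hB, Complex.normSq_apply, mul_comm, add_comm]
  rw [fsDensity, hG, Matrix.det_smul, Matrix.det_one_sub_mul_comm, hBB]
  have h2 : (1 : Matrix (Fin 2) (Fin 2) ℝ) - (1 - s⁻¹) • 1 = s⁻¹ • 1 := by
    rw [sub_smul, one_smul, sub_sub_cancel]
  rw [h2, Matrix.det_smul, Matrix.det_one, mul_one, ← pow_add, ← inv_pow]
  simp only [Fintype.card_prod, Fintype.card_fin]
  rw [show n * 2 + 2 = (n + 1) * 2 by ring, pow_mul, Real.sqrt_sq (by positivity)]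

/-- Changing the representative by `c` multiplies the form by `|c|² > 0`, so its sign may be read
off at `(ζ, 1)`. -/
theorem affineChart_mem_quadricDomain {n : ℕ} (a : Fin (n + 1) → ℝ) (ζ : Fin n → ℂ) :
    affineChart ζ ∈ quadricDomain (Matrix.diagonal fun i => (a i : ℂ)) ↔
      0 < ∑ j, a j.castSucc * Complex.normSq (ζ j) + a (Fin.last n) := by
  have hform : ∀ z : Fin (n + 1) → ℂ,
      (∑ j, ((Matrix.diagonal fun i => (a i : ℂ)).mulVec z) j * (starRingEnd ℂ) (z j)).re =
        ∑ j, a j * Complex.normSq (z j) := by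
    intro z
    rw [Complex.re_sum]
    refine Finset.sum_congr rfl fun j _ => ?_
    rw [Matrix.mulVec_diagonal, mul_assoc, Complex.mul_conj, ← Complex.ofReal_mul,
      Complex.ofReal_re]
  have hval : ∑ j, a j.castSucc * Complex.normSq (ζ j) + a (Fin.last n) =
      ∑ j, a j * Complex.normSq ((Fin.snoc (α := fun _ => ℂ) ζ 1 : Fin (n + 1) → ℂ) j) := by
    simp [Fin.sum_univ_castSucc]
  rw [hval]
  constructor
  · rintro ⟨z, hz, h, hpos⟩
    rw [hform] at hpos
    obtain ⟨c, hc⟩ := (Projectivization.mk_eq_mk_iff ℂ _ _ (snoc_one_ne_zero ζ) hz).1 h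
    rw [← hc]
    have hc0 : 0 < Complex.normSq (c : ℂ) := Complex.normSq_pos.2 c.ne_zero
    have : ∀ j, a j * Complex.normSq ((c • z) j) =
        Complex.normSq (c : ℂ) * (a j * Complex.normSq (z j)) := by
      intro j
      rw [Pi.smul_apply, Units.smul_def, smul_eq_mul, Complex.normSq_mul]
      ring
    simp_rw [this, ← Finset.mul_sum]
    positivity
  · intro h
    exact ⟨_, snoc_one_ne_zero ζ, rfl, by rwa [hform]⟩

/-! ### Volume as a probability -/

/-- The probability that `∑ i, a i * E i` is positive, for independent standard exponential
variables `E i`. -/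
noncomputable def expProb {n : ℕ} (a : Fin n → ℝ) : ℝ≥0∞ :=
  Measure.pi (fun _ => stdExp) {t : Fin n → ℝ | 0 < ∑ i, a i * t i}

theorem measurableSet_sum_pos {n : ℕ} (a : Fin n → ℝ) :
    MeasurableSet {t : Fin n → ℝ | 0 < ∑ i, a i * t i} :=
  measurableSet_lt measurable_const (by fun_prop)

/-- The indicator function of the positive reals. -/
noncomputable def posInd : ℝ → ℝ≥0∞ := (Ioi (0 : ℝ)).indicator 1

theorem posInd_of_pos {v : ℝ} (h : 0 < v) : posInd v = 1 := indicator_of_mem (mem_Ioi.2 h) _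

theorem posInd_of_nonpos {v : ℝ} (h : v ≤ 0) : posInd v = 0 :=
  indicator_of_notMem (notMem_Ioi.2 h) _

theorem posInd_mul {u : ℝ} (hu : 0 < u) (v : ℝ) : posInd (u * v) = posInd v := by
  rcases lt_or_ge 0 v with h | h
  · rw [posInd_of_pos h, posInd_of_pos (mul_pos hu h)]
  · rw [posInd_of_nonpos h, posInd_of_nonpos (mul_nonpos_of_nonneg_of_nonpos hu.le h)]

@[fun_prop]
theorem measurable_posInd : Measurable posInd :=
  measurable_one.indicator measurableSet_Ioi

theorem expProb_eq_lintegral {n : ℕ} (a : Fin n → ℝ) :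
    expProb a = ∫⁻ t, posInd (∑ i, a i * t i) ∂Measure.pi (fun _ : Fin n => stdExp) := by
  rw [expProb, ← lintegral_indicator_one (measurableSet_sum_pos a)]
  rfl

theorem lintegral_pow_mul_exp_neg (n : ℕ) {s : ℝ} (hs : 0 < s) :
    ∫⁻ u in Ioi (0 : ℝ), ENNReal.ofReal (u ^ n * Real.exp (-(s * u))) =
      ENNReal.ofReal ((n)! * (s ^ (n + 1))⁻¹) := by
  have h := Real.integral_rpow_mul_exp_neg_mul_Ioi (a := n + 1) (by positivity) hs
  simp only [add_sub_cancel_right, Real.rpow_natCast, Real.Gamma_nat_eq_factorial] at h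
  have hval : (n)! * (s ^ (n + 1))⁻¹ = (1 / s) ^ ((n : ℝ) + 1) * ((n)! : ℝ) := by
    rw [← Nat.cast_add_one, Real.rpow_natCast, one_div, inv_pow, mul_comm]
  rw [hval, ← h, ofReal_integral_eq_lintegral_ofReal]
  -- A non-integrable function would have Bochner integral `0`, but the value found is positive.
  · by_contra hni
    rw [integral_undef hni] at h
    have : 0 < (1 / s) ^ ((n : ℝ) + 1) * ((n)! : ℝ) := by positivity
    exact this.ne h
  · exact (ae_restrict_iff' measurableSet_Ioi).2 (ae_of_all _ fun u hu =>
      mul_nonneg (pow_nonneg (le_of_lt hu) _) (Real.exp_pos _).le)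

/-- Fix the last exponential variable `u` and substitute `t j = u * |ζ j|²`. The event becomes `u *
L ζ > 0`, which no longer depends on `u`, and the weight becomes `u ^ n * exp (-u * (1 + |ζ|²))`.
Integrating over `u` gives `n! / (1 + |ζ|²) ^ (n + 1)`, which is `n!` times the Fubini–Study
density. -/
theorem factorial_mul_fsVolume {n : ℕ} (a : Fin (n + 1) → ℝ) :
    ((n)! : ℝ≥0∞) * fsVolume (quadricDomain (Matrix.diagonal fun i => (a i : ℂ))) =
      (NNReal.pi : ℝ≥0∞) ^ n * expProb a := by
  have hq : Measurable Complex.normSq := Complex.continuous_normSq.measurable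
  set L : (Fin n → ℂ) → ℝ := fun ζ => ∑ j, a j.castSucc * Complex.normSq (ζ j) + a (Fin.last n)
    with hL
  have hLm : Measurable L := by fun_prop
  have hU : MeasurableSet {ζ | 0 < L ζ} := measurableSet_lt measurable_const hLm
  have hpre : affineChart ⁻¹' quadricDomain (Matrix.diagonal fun i => (a i : ℂ)) =
      {ζ | 0 < L ζ} := by
    ext ζ
    exact affineChart_mem_quadricDomain a ζ
  have hslice : ∀ u : ℝ, 0 < u →
      (NNReal.pi : ℝ≥0∞) ^ n * ∫⁻ t, posInd (∑ j : Fin n, a j.castSucc * t j + a (Fin.last n) * u)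
        ∂Measure.pi (fun _ : Fin n => stdExp) =
      ∫⁻ ζ, ENNReal.ofReal (u ^ n * Real.exp (-(u * ∑ j, Complex.normSq (ζ j)))) * posInd (L ζ) := by
    intro u hu
    have h := lintegral_pi_change (n := n) (volume : Measure ℂ) stdExp
      (g := fun _ z => ENNReal.ofReal (u * Real.exp (-(u * Complex.normSq z))))
      (θ := fun _ z => u * Complex.normSq z)
      (fun _ => by fun_prop) (fun _ => by fun_prop) (fun _ => NNReal.pi) (fun _ => normSq_map hu)
      (f := fun t => posInd (∑ j : Fin n, a j.castSucc * t j + a (Fin.last n) * u)) (by fun_prop)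
    rw [Finset.prod_const, Finset.card_univ, Fintype.card_fin] at h
    rw [← h, volume_pi]
    refine lintegral_congr fun ζ => ?_
    congr 1
    · rw [← ENNReal.ofReal_prod_of_nonneg fun _ _ => by positivity, Finset.prod_mul_distrib,
        Finset.prod_const, Finset.card_univ, Fintype.card_fin, ← Real.exp_sum,
        Finset.sum_neg_distrib, Finset.mul_sum]
    · have : ∑ j : Fin n, a j.castSucc * (u * Complex.normSq (ζ j)) + a (Fin.last n) * u =
          u * L ζ := by
        rw [hL, mul_add, Finset.mul_sum]
        congr 1
        · exact Finset.sum_congr rfl fun _ _ => by ring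
        · ring
      rw [this, posInd_mul hu]
  have hprob : expProb a = ∫⁻ u, ∫⁻ t, posInd (∑ j : Fin n, a j.castSucc * t j + a (Fin.last n) * u)
      ∂Measure.pi (fun _ : Fin n => stdExp) ∂stdExp := by
    rw [expProb_eq_lintegral, lintegral_pi_snoc _ (by fun_prop), lintegral_lintegral_swap]
    · simp only [Fin.sum_univ_castSucc, Fin.snoc_castSucc, Fin.snoc_last]
    · simp only [Fin.sum_univ_castSucc, Fin.snoc_castSucc, Fin.snoc_last,
        Function.uncurry_def]
      fun_prop
  have hm2 : Measurable fun u =>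
      ∫⁻ t, posInd (∑ j : Fin n, a j.castSucc * t j + a (Fin.last n) * u)
        ∂Measure.pi (fun _ : Fin n => stdExp) :=
    Measurable.lintegral_prod_right' (f := fun p : ℝ × (Fin n → ℝ) =>
      posInd (∑ j : Fin n, a j.castSucc * p.2 j + a (Fin.last n) * p.1)) (by fun_prop)
  rw [hprob, lintegral_stdExp hm2, ← lintegral_const_mul _ (by fun_prop)]
  have h1 : ∀ u ∈ Ioi (0 : ℝ), (NNReal.pi : ℝ≥0∞) ^ n * (ENNReal.ofReal (Real.exp (-u)) *
      ∫⁻ t, posInd (∑ j : Fin n, a j.castSucc * t j + a (Fin.last n) * u)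
        ∂Measure.pi (fun _ : Fin n => stdExp)) =
      ∫⁻ ζ : Fin n → ℂ, ENNReal.ofReal
        (u ^ n * Real.exp (-((1 + ∑ j, Complex.normSq (ζ j)) * u))) * posInd (L ζ) := by
    intro u hu
    rw [mul_left_comm, hslice u hu, ← lintegral_const_mul _ (by fun_prop)]
    refine lintegral_congr fun ζ => ?_
    rw [← mul_assoc, ← ENNReal.ofReal_mul (Real.exp_pos _).le, mul_left_comm, ← Real.exp_add]
    congr 4
    ring
  rw [setLIntegral_congr_fun measurableSet_Ioi h1, lintegral_lintegral_swap, fsVolume, hpre,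
    ← lintegral_const_mul' _ _ (ENNReal.natCast_ne_top _), ← lintegral_indicator hU]
  · refine lintegral_congr fun ζ => ?_
    rw [lintegral_mul_const _ (by fun_prop),
      lintegral_pow_mul_exp_neg n (one_add_sum_normSq_pos ζ), ← fsDensity_eq]
    by_cases h : 0 < L ζ
    · rw [indicator_of_mem (show ζ ∈ {ζ | 0 < L ζ} from h), posInd_of_pos h, mul_one,
        ENNReal.ofReal_mul (Nat.cast_nonneg _), ENNReal.ofReal_natCast]
    · rw [indicator_of_notMem (show ζ ∉ {ζ | 0 < L ζ} from h), posInd_of_nonpos (not_lt.1 h), mul_zero]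
  · simp only [Function.uncurry_def]
    fun_prop

/-- The normalized volumes in terms of independent exponential variables. -/
theorem normalizedVolume_eq (p q : ℕ) (x : Fin p → ℝ) (y : Fin q → ℝ) :
    normalizedVolume p q x y = D x y * (expProb (Fin.append x fun k => -y k)).toReal := by
  unfold normalizedVolume
  split_ifs with h
  -- The conventional value `0` agrees with the formula, since an empty sum is never positive.
  · obtain ⟨rfl, rfl⟩ := Prod.mk.inj h
    simp [expProb]
  · have hpq : p + q ≠ 0 := fun h0 => h (by simp only [Prod.mk.injEq]; omega)
    rw [mul_comm (_ / _), mul_assoc]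
    congr 1
    rw [diagMatrix]
    -- Only the total length matters from here; abstracting `p + q` lets it be replaced by `n + 1`,
    -- the successor case of `fsVolume`.
    generalize (Fin.append x fun k => -y k) = a
    generalize p + q = m at a hpq
    obtain ⟨n, rfl⟩ := Nat.exists_eq_succ_of_ne_zero hpq
    have := congrArg ENNReal.toReal (factorial_mul_fsVolume a)
    rw [ENNReal.toReal_mul, ENNReal.toReal_mul, ENNReal.toReal_pow, ENNReal.toReal_natCast,
      ENNReal.coe_toReal, NNReal.coe_real_pi] at this
    rw [Nat.succ_sub_one, div_mul_eq_mul_div, div_eq_iff (by positivity), this, mul_comm]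

/-! ### Symmetry, complement, continuity and positivity of the probability -/

theorem expProb_comp_equiv {n m : ℕ} (e : Fin n ≃ Fin m) (a : Fin m → ℝ) :
    expProb (fun i => a (e i)) = expProb a := by
  have h := measurePreserving_piCongrLeft (fun _ : Fin m => stdExp) e
  rw [expProb, expProb, ← h.measure_preimage_equiv]
  congr 1
  ext t
  have : ∀ i, MeasurableEquiv.piCongrLeft (fun _ => ℝ) e t (e i) = t i := fun i =>
    Equiv.piCongrLeft_apply_apply (fun _ => ℝ) e t i
  simp only [mem_ofPred_eq, mem_preimage]
  rw [← e.sum_comp]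
  simp only [this]

theorem pi_stdExp_absolutelyContinuous (n : ℕ) :
    Measure.pi (fun _ : Fin n => stdExp) ≪ volume := by
  have hm : Measurable fun t : ℝ => ENNReal.ofReal (Real.exp (-t)) := by fun_prop
  have h := pi_withDensity_map (n := n) (volume : Measure ℝ) (fun _ => stdExp)
    (g := fun _ => (Ioi 0).indicator fun t => ENNReal.ofReal (Real.exp (-t)))
    (fun _ => hm.indicator measurableSet_Ioi) (θ := fun _ t => t) (fun _ => measurable_id)
    (fun _ => by
      rw [withDensity_indicator measurableSet_Ioi]
      exact Measure.map_id)
  rw [← h, ← volume_pi]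
  exact Measure.map_id.absolutelyContinuous.trans (withDensity_absolutelyContinuous _ _)

/-- The exceptional set is the kernel of a nonzero linear functional, a proper subspace and hence
Lebesgue-null. -/
theorem ae_sum_ne_zero {n : ℕ} {a : Fin n → ℝ} (ha : a ≠ 0) :
    ∀ᵐ t ∂Measure.pi (fun _ : Fin n => stdExp), ∑ i, a i * t i ≠ 0 := by
  apply (pi_stdExp_absolutelyContinuous n).ae_le
  obtain ⟨i, hi⟩ := Function.ne_iff.1 ha
  let f : (Fin n → ℝ) →ₗ[ℝ] ℝ := ∑ i, a i • LinearMap.proj i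
  have hf : ∀ t, f t = ∑ i, a i * t i := fun t => by simp [f]
  have hker : LinearMap.ker f ≠ ⊤ := by
    intro h
    have : f (Pi.single i 1) = 0 := by
      rw [← LinearMap.mem_ker, h]
      trivial
    rw [hf, Finset.sum_eq_single i] at this
    · exact hi (by simpa using this)
    · intro j _ hj
      simp [hj]
    · simp
  change ∀ᵐ t : Fin n → ℝ, ∑ i, a i * t i ≠ 0
  rw [ae_iff]
  convert Measure.addHaar_submodule volume _ hker using 2
  ext t
  simp [hf]

theorem expProb_add_neg {n : ℕ} {a : Fin n → ℝ} (ha : a ≠ 0) :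
    expProb a + expProb (fun i => -a i) = 1 := by
  have h : expProb (fun i => -a i) =
      Measure.pi (fun _ : Fin n => stdExp) {t : Fin n → ℝ | 0 < ∑ i, a i * t i}ᶜ := by
    refine measure_congr ?_
    filter_upwards [ae_sum_ne_zero ha] with t ht
    refine propext ?_
    change (0 < ∑ i, -a i * t i) ↔ ¬ (0 < ∑ i, a i * t i)
    simp only [neg_mul, Finset.sum_neg_distrib, Left.neg_pos_iff, not_lt]
    exact ht.le_iff_lt.symm
  rw [h]
  exact prob_add_prob_compl (measurableSet_sum_pos a)

theorem expProb_ne_top {n : ℕ} (a : Fin n → ℝ) : expProb a ≠ ∞ := measure_ne_top _ _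

/-- For almost every `t` the sum at `a` is nonzero, so its sign is locally constant in the
coefficients and the indicators of the events converge almost everywhere. -/
theorem continuousAt_expProb {n : ℕ} {a : Fin n → ℝ} (ha : a ≠ 0) :
    ContinuousAt (fun a : Fin n → ℝ => (expProb a).toReal) a := by
  refine (ENNReal.tendsto_toReal (expProb_ne_top a)).comp ?_
  refine tendsto_measure_of_ae_tendsto_indicator_of_isFiniteMeasure _ (measurableSet_sum_pos a)
    measurableSet_sum_pos ?_
  filter_upwards [ae_sum_ne_zero ha] with t ht
  have hc : ContinuousAt (fun b : Fin n → ℝ => ∑ i, b i * t i) a :=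
    (continuous_finsetSum _ fun i _ => (continuous_apply i).mul_const _).continuousAt
  rcases lt_or_gt_of_ne ht with h | h
  · filter_upwards [hc.eventually_lt continuousAt_const h] with b hb
    exact iff_of_false (not_lt.2 hb.le) (not_lt.2 h.le)
  · filter_upwards [continuousAt_const.eventually_lt hc h] with b hb
    exact iff_of_true hb h

theorem expProb_pos {n : ℕ} {a : Fin n → ℝ} {i : Fin n} (hi : 0 < a i) : 0 < expProb a := by
  -- If `t i > M` and the other coordinates lie in `(0, 1)`, the `i`-th term outweighs all others
  -- together; this box has positive measure.
  set M := (∑ j, |a j|) / a i with hM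
  have hM0 : 0 ≤ M := div_nonneg (Finset.sum_nonneg fun _ _ => abs_nonneg _) hi.le
  have hbox : (univ.pi fun j => if j = i then Ioi M else Ioo (0 : ℝ) 1) ⊆
      {t : Fin n → ℝ | 0 < ∑ j, a j * t j} := by
    intro t ht
    have hti : M < t i := by simpa using ht i (mem_univ i)
    have hlt : ∑ j, |a j| < a i * t i := by
      rw [hM, div_lt_iff₀ hi] at hti
      linarith
    have hle : -∑ j ∈ Finset.univ.erase i, |a j| ≤ ∑ j ∈ Finset.univ.erase i, a j * t j := by
      rw [← Finset.sum_neg_distrib]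
      refine Finset.sum_le_sum fun j hj => ?_
      have htj : 0 < t j ∧ t j < 1 := by
        simpa [Finset.ne_of_mem_erase hj] using ht j (mem_univ j)
      have h1 : |a j * t j| ≤ |a j| := by
        rw [abs_mul, abs_of_pos htj.1]
        exact mul_le_of_le_one_right (abs_nonneg _) htj.2.le
      exact (neg_le_neg h1).trans (neg_abs_le _)
    change 0 < ∑ j, a j * t j
    rw [← Finset.add_sum_erase _ _ (Finset.mem_univ i)] at hlt ⊢
    linarith [abs_nonneg (a i)]
  refine lt_of_lt_of_le ?_ (measure_mono hbox)
  rw [Measure.pi_pi, pos_iff_ne_zero, Finset.prod_ne_zero_iff]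
  intro j _
  split_ifs
  · rw [stdExp_Ioi hM0]
    exact (ENNReal.ofReal_pos.2 (Real.exp_pos _)).ne'
  · exact (stdExp_Ioo_pos one_pos).ne'

/-! ### Integrating out one variable -/

/-- Let `S = ∑ a i * t i`. The event `S > 0` splits according to whether the new variable `u` lies
below `S / s`; the first part is the event for the extended vector. The second has conditional
probability `exp (-S / s)`, and this weight gives `t i` the rate `(s + a i) / s`, positive by `ha`.
-/
theorem expProb_eq_snoc_add {n : ℕ} (a : Fin n → ℝ) {s : ℝ} (hs : 0 < s)
    (ha : ∀ i, 0 < s + a i) :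
    expProb a = expProb (Fin.snoc (α := fun _ => ℝ) a (-s)) +
      ENNReal.ofReal (∏ i, s / (s + a i)) * expProb fun i => a i / (s + a i) := by
  have hsnoc : expProb (Fin.snoc (α := fun _ => ℝ) a (-s)) =
      ∫⁻ t, stdExp (Iio ((∑ i, a i * t i) / s)) ∂Measure.pi (fun _ : Fin n => stdExp) := by
    rw [expProb_eq_lintegral, lintegral_pi_snoc _ (by fun_prop)]
    refine lintegral_congr fun t => ?_
    rw [← lintegral_indicator_one measurableSet_Iio]
    refine lintegral_congr fun u => ?_
    simp only [Fin.sum_univ_castSucc, Fin.snoc_castSucc, Fin.snoc_last]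
    by_cases h : u < (∑ i, a i * t i) / s
    · rw [indicator_of_mem (mem_Iio.2 h), posInd_of_pos, Pi.one_apply]
      rw [lt_div_iff₀ hs] at h
      linarith
    · rw [indicator_of_notMem (notMem_Iio.2 (not_lt.1 h)), posInd_of_nonpos]
      rw [not_lt, div_le_iff₀ hs] at h
      linarith
  have htilt : ∫⁻ t, ENNReal.ofReal (Real.exp (-((∑ i, a i * t i) / s))) *
      posInd (∑ i, a i * t i) ∂Measure.pi (fun _ : Fin n => stdExp) =
      ENNReal.ofReal (∏ i, s / (s + a i)) * expProb fun i => a i / (s + a i) := by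
    have hr : ∀ i, 0 < (s + a i) / s := fun i => div_pos (ha i) hs
    have h := lintegral_pi_change stdExp stdExp (n := n)
      (g := fun i t => ENNReal.ofReal (Real.exp ((1 - (s + a i) / s) * t)))
      (θ := fun i t => (s + a i) / s * t) (fun _ => by fun_prop) (fun _ => by fun_prop)
      (fun i => ((s + a i) / s)⁻¹.toNNReal) (fun i => stdExp_tilt (hr i))
      (f := fun t => posInd (∑ i, a i / (s + a i) * t i)) (by fun_prop)
    rw [expProb_eq_lintegral, ENNReal.ofReal_prod_of_nonneg fun i _ => (div_pos hs (ha i)).le]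
    simp only [inv_div] at h
    refine Eq.trans ?_ h
    refine lintegral_congr fun t => ?_
    congr 1
    · rw [← ENNReal.ofReal_prod_of_nonneg fun _ _ => by positivity, ← Real.exp_sum,
        Finset.sum_div, ← Finset.sum_neg_distrib]
      congr 2
      refine Finset.sum_congr rfl fun i _ => ?_
      field_simp
      ring
    -- In the rescaled variables the coefficient of `t i` is `a i / s`; the common positive factor
    -- `s⁻¹` does not affect the sign.
    · rw [← posInd_mul (inv_pos.2 hs), Finset.mul_sum]
      congr 1
      refine Finset.sum_congr rfl fun i _ => ?_
      have := (ha i).ne'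
      field_simp
  rw [hsnoc, ← htilt, expProb_eq_lintegral, ← lintegral_add_right _ (by fun_prop)]
  refine lintegral_congr fun t => ?_
  rcases lt_or_ge 0 (∑ i, a i * t i) with h | h
  · rw [posInd_of_pos h, mul_one, stdExp_Iio_add (div_pos h hs).le]
  · rw [posInd_of_nonpos h, mul_zero, add_zero,
      stdExp_Iio_of_nonpos (div_nonpos_of_nonpos_of_nonneg h hs.le)]

/-- Removing the only variable leaves the empty vector, whose probability `0` is a sum of two
nonnegative terms, one of them the probability sought. -/
theorem expProb_fin_one_of_neg {a : Fin 1 → ℝ} (ha : a 0 < 0) : expProb a = 0 := by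
  have h := expProb_eq_snoc_add (n := 0) (fun i => a i.castSucc) (neg_pos.2 ha)
    fun i => i.elim0
  have h0 : expProb (fun i : Fin 0 => a i.castSucc) = 0 := by simp [expProb]
  have hsnoc : (Fin.snoc (α := fun _ => ℝ) (fun i : Fin 0 => a i.castSucc) (- -a 0) :
      Fin 1 → ℝ) = a := by
    ext i
    obtain rfl : i = Fin.last 0 := Fin.ext (by omega)
    rw [Fin.snoc_last, neg_neg]
    rfl
  rw [h0, hsnoc] at h
  exact (add_eq_zero.1 h.symm).1

/-! ### Translation to the normalized volumes -/

theorem D_pos {p q : ℕ} {x : Fin p → ℝ} {y : Fin q → ℝ} (hx : x ∈ orthant p)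
    (hy : y ∈ orthant q) : 0 < D x y :=
  Finset.prod_pos fun k _ => Finset.prod_pos fun j _ => add_pos (hx j) (hy k)

theorem D_comm {p q : ℕ} (x : Fin p → ℝ) (y : Fin q → ℝ) : D x y = D y x := by
  rw [D, D, Finset.prod_comm]
  simp only [add_comm]

theorem D_perm {p q : ℕ} (x : Fin p → ℝ) (y : Fin q → ℝ) (s : Equiv.Perm (Fin p))
    (t : Equiv.Perm (Fin q)) : D (fun j => x (s j)) (fun k => y (t k)) = D x y := by
  rw [D, D, ← Equiv.prod_comp t fun k => ∏ j, (x j + y k)]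
  exact Finset.prod_congr rfl fun k _ => Equiv.prod_comp s fun j => x j + y (t k)

theorem D_succ {p q : ℕ} (x : Fin p → ℝ) (y : Fin (q + 1) → ℝ) :
    D x y = D x (fun k => y k.castSucc) * ∏ j, (x j + y (Fin.last q)) :=
  Fin.prod_univ_castSucc _

theorem append_neg_ne_zero {p q : ℕ} (h : (p, q) ≠ (0, 0)) {x : Fin p → ℝ} {y : Fin q → ℝ}
    (hx : x ∈ orthant p) (hy : y ∈ orthant q) : (Fin.append x fun k => -y k) ≠ 0 := by
  intro h0
  rcases p with - | p
  · rcases q with - | q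
    · exact h rfl
    · have := congrFun h0 (Fin.natAdd 0 0)
      rw [Fin.append_right] at this
      exact (neg_neg_of_pos (hy 0)).ne this
  · have := congrFun h0 (Fin.castAdd q 0)
    rw [Fin.append_left] at this
    exact (hx 0).ne' this

theorem continuousOn_normalizedVolume (p q : ℕ) :
    ContinuousOn (fun z : (Fin p → ℝ) × (Fin q → ℝ) => normalizedVolume p q z.1 z.2)
      (orthant p ×ˢ orthant q) := by
  by_cases h : (p, q) = (0, 0)
  · simp only [normalizedVolume, h, if_true]
    exact continuousOn_const
  · simp only [normalizedVolume_eq]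
    rintro ⟨x, y⟩ ⟨hx, hy⟩
    apply ContinuousAt.continuousWithinAt
    have hD : Continuous fun z : (Fin p → ℝ) × (Fin q → ℝ) => D z.1 z.2 := by
      unfold D
      exact continuous_finsetProd _ fun k _ => continuous_finsetProd _ fun j _ => by fun_prop
    have happ : Continuous fun z : (Fin p → ℝ) × (Fin q → ℝ) =>
        Fin.append z.1 fun k => -z.2 k := by
      refine continuous_pi fun i => ?_
      refine Fin.addCases (fun j => ?_) (fun k => ?_) i
      · simp only [Fin.append_left]
        fun_prop
      · simp only [Fin.append_right]
        fun_prop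
    exact hD.continuousAt.mul
      (ContinuousAt.comp (f := fun z : (Fin p → ℝ) × (Fin q → ℝ) =>
        Fin.append z.1 fun k => -z.2 k) (g := fun a => (expProb a).toReal)
        (continuousAt_expProb (append_neg_ne_zero h hx hy)) happ.continuousAt)

theorem normalizedVolume_perm {p q : ℕ} (x : Fin p → ℝ) (y : Fin q → ℝ) (s : Equiv.Perm (Fin p))
    (t : Equiv.Perm (Fin q)) :
    normalizedVolume p q (fun j => x (s j)) (fun k => y (t k)) = normalizedVolume p q x y := by
  rw [normalizedVolume_eq, normalizedVolume_eq, D_perm,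
    ← expProb_comp_equiv ((finSumFinEquiv.symm.trans (Equiv.sumCongr s t)).trans finSumFinEquiv)
      (Fin.append x fun k => -y k)]
  congr 3
  ext i
  refine Fin.addCases (fun j => ?_) (fun k => ?_) i <;> simp

theorem normalizedVolume_duality {p q : ℕ} (h : (p, q) ≠ (0, 0)) {x : Fin p → ℝ}
    {y : Fin q → ℝ} (hx : x ∈ orthant p) (hy : y ∈ orthant q) :
    normalizedVolume p q x y = D x y - normalizedVolume q p y x := by
  -- Exchanging the two blocks turns `(y, -x)` into the negative of `(x, -y)`.
  have hflip : expProb (Fin.append y fun j => -x j) =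
      expProb fun i => -(Fin.append x fun k => -y k) i := by
    rw [← expProb_comp_equiv (finAddFlip : Fin (q + p) ≃ Fin (p + q))]
    congr 1
    ext i
    refine Fin.addCases (fun j => ?_) (fun k => ?_) i <;> simp
  have hadd := congrArg ENNReal.toReal (expProb_add_neg (append_neg_ne_zero h hx hy))
  rw [ENNReal.toReal_add (expProb_ne_top _) (expProb_ne_top _), ENNReal.toReal_one] at hadd
  rw [normalizedVolume_eq, normalizedVolume_eq, D_comm y x, hflip, ← mul_one_sub, ← hadd,
    add_sub_cancel_right]

theorem prod_ratio_append {p q : ℕ} (x : Fin p → ℝ) (y : Fin (q + 1) → ℝ) :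
    ∏ i : Fin (p + q), y (Fin.last q) /
        (y (Fin.last q) + (Fin.append x fun k => -y k.castSucc : Fin (p + q) → ℝ) i) =
      y (Fin.last q) ^ (p + q) / ((∏ j, (y (Fin.last q) + x j)) *
        ∏ k : Fin q, (y (Fin.last q) - y k.castSucc)) := by
  simp only [Fin.prod_univ_add, Fin.append_left, Fin.append_right, Finset.prod_div_distrib,
    Finset.prod_const, Finset.card_univ, Fintype.card_fin, ← sub_eq_add_neg]

/-- Identifies `T` as the factor for which the constant `∏ s / (s + a i)` of the tilt, multiplied by
`D x y`, equals `T x y * D (alpha x y) (beta y)`. It rests on `α_j + β_k = (x_j + y_k) * s / ((s +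
x_j) * (s - y_k))` with `s = y_last`. -/
theorem T_mul_D {p q : ℕ} {x : Fin p → ℝ} {y : Fin (q + 1) → ℝ} (hx : x ∈ orthant p)
    (hy : y ∈ orthant (q + 1)) (hmono : StrictMono y) :
    T x y * D (alpha x y) (beta y) = D x y * (y (Fin.last q) ^ (p + q) /
      ((∏ j, (y (Fin.last q) + x j)) * ∏ k : Fin q, (y (Fin.last q) - y k.castSucc))) := by
  have hD : D (alpha x y) (beta y) = D x (fun k => y k.castSucc) * y (Fin.last q) ^ (p * q) /
      ((∏ j, (y (Fin.last q) + x j)) ^ q *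
        (∏ k : Fin q, (y (Fin.last q) - y k.castSucc)) ^ p) := by
    have hterm : ∀ (k : Fin q) (j : Fin p), alpha x y j + beta y k =
        (x j + y k.castSucc) * y (Fin.last q) /
          ((y (Fin.last q) + x j) * (y (Fin.last q) - y k.castSucc)) := by
      intro k j
      have h1 : y (Fin.last q) + x j ≠ 0 := (add_pos (hy _) (hx j)).ne'
      have h2 : y (Fin.last q) - y k.castSucc ≠ 0 := (sub_pos.2 (hmono k.castSucc_lt_last)).ne'
      rw [alpha, beta]
      field_simp
      ring
    simp only [D, hterm, Finset.prod_div_distrib, Finset.prod_mul_distrib, Finset.prod_const,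
      Finset.card_univ, Fintype.card_fin, ← pow_mul, Finset.prod_pow]
  have hs : 0 < y (Fin.last q) := hy _
  have hA : 0 < ∏ j, (y (Fin.last q) + x j) := Finset.prod_pos fun j _ => add_pos hs (hx j)
  have hB : 0 < ∏ k : Fin q, (y (Fin.last q) - y k.castSucc) :=
    Finset.prod_pos fun k _ => sub_pos.2 (hmono k.castSucc_lt_last)
  rw [hD, D_succ, T, Finset.prod_pow, Finset.prod_zpow, zpow_sub_one₀ hB.ne', zpow_natCast]
  have hcomm : ∏ j, (x j + y (Fin.last q)) = ∏ j, (y (Fin.last q) + x j) := by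
    simp only [add_comm]
  -- The exponent in `T` equals `p * q - p - q`, which may be negative, hence the integer powers.
  have hexp : y (Fin.last q) ^ (p * q) = y (Fin.last q) ^ (p + q) * y (Fin.last q) ^
      ((p : ℤ) * (q + 1 : ℕ) - 2 * p - (q + 1 : ℕ) + 1) := by
    rw [← zpow_natCast, ← zpow_natCast, ← zpow_add₀ hs.ne']
    congr 1
    push_cast
    ring
  rw [hcomm, hexp]
  have he := (zpow_pos hs ((p : ℤ) * (q + 1 : ℕ) - 2 * p - (q + 1 : ℕ) + 1)).ne'
  field_simp

theorem normalizedVolume_recursion {p q : ℕ} {x : Fin p → ℝ} {y : Fin (q + 1) → ℝ}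
    (hx : x ∈ orthant p) (hy : y ∈ orthant (q + 1)) (hmono : StrictMono y) :
    normalizedVolume p (q + 1) x y =
      (∏ j, (x j + y (Fin.last q))) * normalizedVolume p q x (fun k => y k.castSucc)
        - T x y * normalizedVolume p q (alpha x y) (beta y) := by
  have hs : 0 < y (Fin.last q) := hy _
  -- On the negative block this says `y_k < y_last`: the ordering of `y` is what keeps the tilted
  -- rates positive.
  have ha : ∀ i, 0 < y (Fin.last q) +
      (Fin.append x fun k => -y k.castSucc : Fin (p + q) → ℝ) i := by
    intro i
    refine Fin.addCases (fun j => ?_) (fun k => ?_) i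
    · rw [Fin.append_left]
      exact add_pos hs (hx j)
    · rw [Fin.append_right, ← sub_eq_add_neg]
      exact sub_pos.2 (hmono k.castSucc_lt_last)
  have hsnoc : expProb (Fin.append x fun k => -y k) = expProb (Fin.snoc (α := fun _ => ℝ)
      (Fin.append x fun k => -y k.castSucc : Fin (p + q) → ℝ) (-y (Fin.last q))) := by
    rw [← Fin.append_snoc]
    congr 2
    ext k
    refine Fin.lastCases ?_ (fun k => ?_) k <;> simp
  have hscale : (fun i => (Fin.append x fun k => -y k.castSucc : Fin (p + q) → ℝ) i /
      (y (Fin.last q) + (Fin.append x fun k => -y k.castSucc : Fin (p + q) → ℝ) i)) =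
      Fin.append (alpha x y) fun k => -beta y k := by
    ext i
    refine Fin.addCases (fun j => ?_) (fun k => ?_) i
    · simp [alpha]
    · simp [beta, neg_div, sub_eq_add_neg]
  have key := congrArg ENNReal.toReal (expProb_eq_snoc_add _ hs ha)
  rw [← hsnoc, hscale, ENNReal.toReal_add (expProb_ne_top _)
    (ENNReal.mul_ne_top ENNReal.ofReal_ne_top (expProb_ne_top _)), ENNReal.toReal_mul,
    ENNReal.toReal_ofReal (Finset.prod_nonneg fun i _ => (div_pos hs (ha i)).le),
    prod_ratio_append] at key
  rw [normalizedVolume_eq, normalizedVolume_eq, normalizedVolume_eq, ← mul_assoc (T x y),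
    T_mul_D hx hy hmono, key, D_succ]
  ring

end QuadricVolume

/-- The double sequence of normalized Fubini-Study volumes of quadric domains belongs to the
class `𝒩`. -/
theorem propositionB : QuadricVolume.ClassN QuadricVolume.normalizedVolume := by
  open QuadricVolume in
  exact {
    continuousOn := continuousOn_normalizedVolume
    nonneg := fun p q x hx y hy => by
      rw [normalizedVolume_eq]
      exact mul_nonneg (D_pos hx hy).le ENNReal.toReal_nonneg
    pos := fun p q hp x hx y hy => by
      rw [normalizedVolume_eq]
      refine mul_pos (D_pos hx hy) (ENNReal.toReal_pos (expProb_pos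
        (i := Fin.castAdd q ⟨0, hp⟩) ?_).ne' (expProb_ne_top _))
      rw [Fin.append_left]
      exact hx _
    symm := fun p q x _ y _ s t => normalizedVolume_perm x y s t
    base_zero := fun x _ y _ => rfl
    base_one := fun x hx y hy => by
      -- Duality reduces to `N_{(0,1)}`, whose single coefficient is negative, so its probability
      -- vanishes and only the empty product `D = 1` remains.
      rw [normalizedVolume_duality (by simp) hx hy, normalizedVolume_eq,
        expProb_fin_one_of_neg (neg_neg_of_pos (hx 0))]
      simp [D]
    duality := fun p q h x hx y hy => normalizedVolume_duality h hx hy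
    recursion := fun p q x hx y hy hmono => normalizedVolume_recursion hx hy hmono }
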